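/- Let $M$ be a smooth four-dimensional manifold with a smooth Lorentzian metric $g$ of signature $(1,3)$, let $D$ be its Levi-Civita connection ($Dg=0$, torsion zero), and let $\{\mathbf e_0,\mathbf e_1,\mathbf e_2,\mathbf e_3\}$ be a global smooth $g$-orthonormal tetrad, $g(\mathbf e_a,\mathbf e_b)=\eta_{ab}=\mathrm{diag}(1,-1,-1,-1)$. Let $\mathcal{C}\ell(TM)$ be the Clifford bundle, whose fibre at $x$ is the Clifford algebra of $(T_xM,g_x)$ with $vv=g(v,v)$, and extend $D$ to its sections by $$D_vA=\partial_vA+\tfrac12[\omega_v,A],\qquad \omega_v=\tfrac12\,\omega_v^{bc}\,\mathbf e_b\mathbf e_c,\qquad D_v\mathbf e_c=\omega_v{}^{b}{}_{c}\,\mathbf e_b,\quad \omega_v^{bc}=\omega_v{}^{b}{}_{d}\,\eta^{dc},$$ where $\partial_v$ differentiates the components of $A$ in the multivector basis $\{\mathbf e_{a_1}\wedge\cdots\wedge\mathbf e_{a_k}\}_{a_1<\dots<a_k}$ of the tetrad. For a chart with domain $U$ and coordinates $x^\mu$ let $e_\mu=\partial/\partial x^\mu$, $D_{e_\nu}e_\mu=\Gamma^\alpha_{\nu\mu}e_\alpha$,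 and let $q_\mu=e_\mu\mathbf e_0$ (Clifford product), a section over $U$ of the even Clifford bundle. Then: (1) For every chart and every index $\nu$, Sachs' rule $D_{e_\nu}q_\mu=\Gamma^\alpha_{\nu\mu}q_\alpha$ holds on $U$ for all $\mu$ if and only if $D_{e_\nu}\mathbf e_0=0$ on $U$. (2) Sachs' rule holds on the domain of every chart of $M$, for all $\nu,\mu$, if and only if $D\mathbf e_0=0$ on $M$, i.e. $D_v\mathbf e_0=0$ for every tangent vector $v$. (3) If $D\mathbf e_0=0$, then $\mathrm{Ric}(\mathbf e_0,X)=0$ on $M$ for every smooth vector field $X$, where $\mathrm{Ric}(Y,Z)=\mathrm{tr}\,(V\mapsto R(V,Y)Z)$ and $R(X,Y)Z=D_XD_YZ-D_YD_XZ-D_{[X,Y]}Z$. -/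

import Mathlib

open Bundle Module
open scoped Manifold ContDiff

namespace SachsRule

/-- The model space `ℝ⁴` of a four-dimensional manifold. -/
abbrev E4 : Type := EuclideanSpace ℝ (Fin 4)

/-- The diagonal `(1, -1, -1, -1)` of the Minkowski form. -/
def eta (a : Fin 4) : ℝ := if a = 0 then 1 else -1

section Spacetime

variable {M : Type*} [TopologicalSpace M] [ChartedSpace E4 M] [IsManifold (𝓡 4) ∞ M]

variable (M) in
/-- A smooth Lorentzian metric of signature `(1,3)` on the four-manifold `M`. -/
structure LorentzMetric where
  /-- The scalar product on each tangent space. -/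
  val (x : M) : TangentSpace (𝓡 4) x →L[ℝ] TangentSpace (𝓡 4) x →L[ℝ] ℝ
  symm (x : M) (v w : TangentSpace (𝓡 4) x) : val x v w = val x w v
  signature (x : M) : ∃ b : Basis (Fin 4) ℝ (TangentSpace (𝓡 4) x),
    ∀ a c, val x (b a) (b c) = if a = c then eta a else 0
  contMDiff : ContMDiff (𝓡 4) ((𝓡 4).prod 𝓘(ℝ, E4 →L[ℝ] E4 →L[ℝ] ℝ)) ∞
    (fun x ↦ TotalSpace.mk' (E4 →L[ℝ] E4 →L[ℝ] ℝ)
      (E := fun x : M ↦ TangentSpace (𝓡 4) x →L[ℝ] TangentSpace (𝓡 4) x →L[ℝ] ℝ) x (val x))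

/-- A linear connection `D` on `TM`; `D Y x v` is `(D_v Y)(x)` for `v ∈ T_x M`. -/
abbrev LinearConnection (M : Type*) [TopologicalSpace M] [ChartedSpace E4 M]
    [IsManifold (𝓡 4) ∞ M] : Type _ :=
  CovariantDerivative (𝓡 4) E4 (TangentSpace (𝓡 4) : M → Type _)

/-- `D` is the Levi-Civita connection of `g`: it is a smooth connection with vanishing torsion,
and `D g = 0`, that is `v (g (Y, Z)) = g (D_v Y, Z) + g (Y, D_v Z)`. -/
structure IsLeviCivita (g : LorentzMetric M) (D : LinearConnection M) : Prop where
  smooth : CovariantDerivative.ContMDiffCovariantDerivative D ∞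
  torsion_eq_zero : D.torsion = 0
  metric : ∀ (x : M) (v : TangentSpace (𝓡 4) x) (Y Z : Π y : M, TangentSpace (𝓡 4) y),
    MDifferentiableAt (𝓡 4) ((𝓡 4).prod 𝓘(ℝ, E4)) (T% Y) x →
    MDifferentiableAt (𝓡 4) ((𝓡 4).prod 𝓘(ℝ, E4)) (T% Z) x →
    mvfderiv (𝓡 4) (fun y ↦ g.val y (Y y) (Z y)) x v
      = g.val x (D Y x v) (Z x) + g.val x (Y x) (D Z x v)

/-- A global tetrad: four smooth vector fields, orthonormal for `g` at each point. -/
structure Tetrad (g : LorentzMetric M) where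
  /-- The vector fields `e_0, e_1, e_2, e_3`. -/
  vec (a : Fin 4) (x : M) : TangentSpace (𝓡 4) x
  contMDiff (a : Fin 4) : ContMDiff (𝓡 4) ((𝓡 4).prod 𝓘(ℝ, E4)) ∞ (T% (vec a))
  orthonormal (x : M) (a c : Fin 4) : g.val x (vec a x) (vec c x) = if a = c then eta a else 0

lemma eta_mul_self (a : Fin 4) : eta a * eta a = 1 := by
  unfold eta; split_ifs <;> norm_num

lemma Tetrad.linearIndependent {g : LorentzMetric M} (e : Tetrad g) (x : M) :
    LinearIndependent ℝ (fun a ↦ e.vec a x) := by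
  rw [Fintype.linearIndependent_iff]
  intro c hc a
  have h := congrArg (fun v ↦ g.val x v (e.vec a x)) hc
  simp only [map_sum, map_smul, FunLike.coe_sum, Finset.sum_apply,
    FunLike.coe_smul, Pi.smul_apply, e.orthonormal, smul_eq_mul, mul_ite, mul_zero,
    Finset.sum_ite_eq', Finset.mem_univ, if_true, map_zero, FunLike.coe_zero,
    Pi.zero_apply] at h
  have h2 := eta_mul_self a
  calc c a = (c a * eta a) * eta a := by rw [mul_assoc, h2, mul_one]
    _ = 0 := by rw [h, zero_mul]

/-- The basis `e_0(x), …, e_3(x)` of `T_x M`. -/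
noncomputable def Tetrad.basisAt {g : LorentzMetric M} (e : Tetrad g) (x : M) :
    Basis (Fin 4) ℝ (TangentSpace (𝓡 4) x) :=
  basisOfLinearIndependentOfCardEqFinrank (e.linearIndependent x)
    (by
      change Fintype.card (Fin 4) = finrank ℝ E4
      simp)

/-! ### Curvature -/

/-- The curvature operator `R(X, Y) Z = D_X D_Y Z - D_Y D_X Z - D_{[X, Y]} Z`. -/
noncomputable def curvature (D : LinearConnection M) (X Y Z : Π x : M, TangentSpace (𝓡 4) x)
    (x : M) : TangentSpace (𝓡 4) x :=
  D (fun y ↦ D Z y (Y y)) x (X x) - D (fun y ↦ D Z y (X y)) x (Y x)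
    - D Z x (VectorField.mlieBracket (𝓡 4) X Y x)

/-- The Ricci tensor `Ric(Y, Z) = tr (V ↦ R(V, Y) Z)`, as a function on `M`. The trace is
computed in the tetrad, whose dual basis is `θ^a = η^{aa} g(e_a, ·)`. -/
noncomputable def ricci {g : LorentzMetric M} (e : Tetrad g) (D : LinearConnection M)
    (Y Z : Π x : M, TangentSpace (𝓡 4) x) (x : M) : ℝ :=
  ∑ a, eta a * g.val x (e.vec a x) (curvature D (e.vec a) Y Z x)

/-! ### The Clifford bundle `Cℓ(TM)` and its covariant derivative -/

/-- The scalar product on `T_x M` as a bilinear form. -/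
noncomputable def LorentzMetric.bilinAt (g : LorentzMetric M) (x : M) :
    LinearMap.BilinForm ℝ (TangentSpace (𝓡 4) x) :=
  LinearMap.mk₂ ℝ (fun v w ↦ g.val x v w) (by simp) (by simp) (by simp) (by simp)

/-- The quadratic form `v ↦ g(v, v)` on `T_x M`. -/
noncomputable def LorentzMetric.quadAt (g : LorentzMetric M) (x : M) :
    QuadraticForm ℝ (TangentSpace (𝓡 4) x) :=
  LinearMap.BilinMap.toQuadraticMap (g.bilinAt x)

/-- The fibre at `x` of the Clifford bundle `Cℓ(TM)`: the Clifford algebra of `(T_x M, g_x)`,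
with `v v = g(v, v)`. A Clifford field is an element of `Π x, g.Cl x`. -/
abbrev LorentzMetric.Cl (g : LorentzMetric M) (x : M) : Type :=
  CliffordAlgebra (g.quadAt x)

/-- The inclusion `T_x M ⊂ Cℓ(T_x M)`. -/
noncomputable abbrev LorentzMetric.toCl (g : LorentzMetric M) (x : M) :
    TangentSpace (𝓡 4) x →ₗ[ℝ] g.Cl x :=
  CliffordAlgebra.ι (g.quadAt x)

/-- The multivector basis `e_{a₁} ∧ ⋯ ∧ e_{aₖ}` (with `a₁ < ⋯ < aₖ`, one for each subset of
`{0,1,2,3}`) of `Cℓ(T_x M)` determined by the tetrad, under the canonical identification of the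
Clifford algebra with the exterior algebra as a vector space. -/
noncomputable def Tetrad.multivectorBasis {g : LorentzMetric M} (e : Tetrad g) (x : M) :
    Basis (Finset (Fin 4)) ℝ (g.Cl x) :=
  (e.basisAt x).ExteriorAlgebra.map (CliffordAlgebra.equivExterior (g.quadAt x)).symm

/-- `∂_v A`: differentiation along `v ∈ T_x M` of the components of the Clifford field `A` with
respect to the multivector basis of the tetrad. -/
noncomputable def partialDeriv {g : LorentzMetric M} (e : Tetrad g) (A : Π x : M, g.Cl x)
    (x : M) (v : TangentSpace (𝓡 4) x) : g.Cl x :=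
  ∑ S : Finset (Fin 4),
    mvfderiv (𝓡 4) (fun y ↦ (e.multivectorBasis y).repr (A y) S) x v • e.multivectorBasis x S

/-- The connection bivector `ω_v = ½ ω_v^{bc} e_b e_c`, where `D_v e_c = ω_v^b_c e_b`, so that
`ω_v^{bc} = η^{bb} η^{cc} g(e_b, D_v e_c)`. -/
noncomputable def connectionBivector {g : LorentzMetric M} (e : Tetrad g)
    (D : LinearConnection M) (x : M) (v : TangentSpace (𝓡 4) x) : g.Cl x :=
  (1 / 2 : ℝ) • ∑ b, ∑ c, (eta b * eta c * g.val x (e.vec b x) (D (e.vec c) x v)) •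
    (g.toCl x (e.vec b x) * g.toCl x (e.vec c x))

/-- The covariant derivative `D_v A = ∂_v A + ½ [ω_v, A]` of a Clifford field `A`. -/
noncomputable def cliffordDeriv {g : LorentzMetric M} (e : Tetrad g) (D : LinearConnection M)
    (A : Π x : M, g.Cl x) (x : M) (v : TangentSpace (𝓡 4) x) : g.Cl x :=
  partialDeriv e A x v + (1 / 2 : ℝ) •
    (connectionBivector e D x v * A x - A x * connectionBivector e D x v)

/-! ### Coordinate fields, connection coefficients and paravector fields -/

/-- The coordinate vector field `e_μ = ∂/∂x^μ` of a chart `φ` (meaningful on `φ.source`). -/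
noncomputable def coordField (φ : OpenPartialHomeomorph M E4) (μ : Fin 4) (x : M) :
    TangentSpace (𝓡 4) x :=
  (mvfderiv (𝓡 4) φ x).inverse (EuclideanSpace.single μ 1)

/-- The connection coefficient `Γ^α_{νμ} = dx^α (D_{e_ν} e_μ)` of `D` in the chart `φ`, so that
`D_{e_ν} e_μ = Γ^α_{νμ} e_α` on `φ.source`. -/
noncomputable def connCoeff (D : LinearConnection M) (φ : OpenPartialHomeomorph M E4)
    (α ν μ : Fin 4) (x : M) : ℝ :=
  mvfderiv (𝓡 4) (fun y ↦ φ y α) x (D (coordField φ μ) x (coordField φ ν x))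

/-- The paravector field `q_μ = e_μ e_0` (Clifford product of the coordinate field `e_μ` and the
timelike tetrad field `e_0`). -/
noncomputable def paravector {g : LorentzMetric M} (e : Tetrad g)
    (φ : OpenPartialHomeomorph M E4) (μ : Fin 4) (x : M) : g.Cl x :=
  g.toCl x (coordField φ μ x) * g.toCl x (e.vec 0 x)

/-- The paravector fields are sections of the even Clifford bundle. -/
lemma paravector_mem_even {g : LorentzMetric M} (e : Tetrad g)
    (φ : OpenPartialHomeomorph M E4) (μ : Fin 4) (x : M) :
    paravector e φ μ x ∈ CliffordAlgebra.even (g.quadAt x) :=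
  CliffordAlgebra.ι_mul_ι_mem_evenOdd_zero _ _ _

/-- Sachs' rule `D_{e_ν} q_μ = Γ^α_{νμ} q_α` at the point `x` of the chart domain of `φ`. -/
def SachsRuleAt {g : LorentzMetric M} (e : Tetrad g) (D : LinearConnection M)
    (φ : OpenPartialHomeomorph M E4) (ν μ : Fin 4) (x : M) : Prop :=
  cliffordDeriv e D (paravector e φ μ) x (coordField φ ν x)
    = ∑ α, connCoeff D φ α ν μ x • paravector e φ α x

end Spacetime

end SachsRule

open SachsRule

/-!
The proof works pointwise in the tetrad. Writing `X = X^b e_b`, metric compatibility gives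
`D_v X = ∂_v X + Ω_v X` (`IsLeviCivita.deriv_eq`), where `Ω_v` is the endomorphism
`connectionEndo` with matrix `ω_v^b_c`, skew for `g`. Because `[e_b e_c, w]` is
`2 g(e_c, w) e_b - 2 g(e_b, w) e_c`, skewness of `Ω_v` makes `½ [ω_v, w] = Ω_v w` in the Clifford
algebra (`IsLeviCivita.half_commutator_connectionBivector`). The products `e_b e_0` have constant
components in the multivector basis: `e_0 e_0 = 1`, and `e_b e_0 = -e_0 ∧ e_b` for `b ≠ 0`.
Together these give the Leibniz rule `D_v (X e_0) = (D_v X) e_0 + X (D_v e_0)`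
(`IsLeviCivita.cliffordDeriv_toCl_mul_vec_zero`).

For `X = e_μ` the first summand is `Γ^α_{νμ} q_α`, so Sachs' rule at a point says
`e_μ (D_{e_ν} e_0) = 0`. If this holds for all `μ`, then by linearity `e_0 (D_{e_ν} e_0) = 0`, and
`e_0 e_0 = 1` cancels the factor `e_0` (`IsLeviCivita.forall_sachsRuleAt_iff`). The coordinate
fields span each tangent space, which gives the global version.

For the Ricci tensor, let `D e_0 = 0`. Then `R(X, e_a) e_0 = 0`, so the first Bianchi identity
(`IsLeviCivita.bianchi`, which is the Jacobi identity for a torsion-free connection) becomes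
`R(e_a, e_0) X = -R(e_0, X) e_a`. The right-hand side is orthogonal to `e_a` because the curvature
operator of a metric connection is skew (`IsLeviCivita.val_curvature_vec_self`). Hence every term
of the trace `Ric(e_0, X)` vanishes separately.
-/

namespace SachsRule

/-! ### Coordinate fields of a chart -/

section Charts

variable {M : Type*} [TopologicalSpace M] [ChartedSpace E4 M] {φ : OpenPartialHomeomorph M E4}

lemma isInvertible_mvfderiv_chart (hφ : φ ∈ IsManifold.maximalAtlas (𝓡 4) ∞ M) {x : M}
    (hx : x ∈ φ.source) : (mvfderiv (𝓡 4) φ x).IsInvertible := by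
  have h : OpenPartialHomeomorph.MDifferentiable (𝓡 4) 𝓘(ℝ, E4) φ :=
    ⟨(contMDiffOn_of_mem_maximalAtlas hφ).mdifferentiableOn (by simp),
      (contMDiffOn_symm_of_mem_maximalAtlas hφ).mdifferentiableOn (by simp)⟩
  exact ⟨h.mfderiv hx, rfl⟩

lemma mvfderiv_coord (hφ : φ ∈ IsManifold.maximalAtlas (𝓡 4) ∞ M) {x : M}
    (hx : x ∈ φ.source) (α : Fin 4) (w : TangentSpace (𝓡 4) x) :
    mvfderiv (𝓡 4) (fun y ↦ φ y α) x w = mvfderiv (𝓡 4) φ x w α := by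
  have hφx : MDifferentiableAt (𝓡 4) 𝓘(ℝ, E4) φ x :=
    (contMDiffAt_of_mem_maximalAtlas hφ hx).mdifferentiableAt (by simp)
  have hp : MDifferentiableAt 𝓘(ℝ, E4) 𝓘(ℝ, ℝ) (EuclideanSpace.proj α : E4 →L[ℝ] ℝ) (φ x) :=
    (EuclideanSpace.proj α : E4 →L[ℝ] ℝ).mdifferentiableAt
  have h := mvfderiv_comp_apply (I := 𝓡 4) (I' := 𝓘(ℝ, E4)) x hp hφx w
  refine h.trans ?_
  rw [mvfderiv, ContinuousLinearMap.mfderiv_eq]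
  rfl

lemma sum_mvfderiv_smul_coordField (hφ : φ ∈ IsManifold.maximalAtlas (𝓡 4) ∞ M) {x : M}
    (hx : x ∈ φ.source) (w : TangentSpace (𝓡 4) x) :
    ∑ α, mvfderiv (𝓡 4) (fun y ↦ φ y α) x w • coordField φ α x = w := by
  have hinv := isInvertible_mvfderiv_chart hφ hx
  simp_rw [mvfderiv_coord hφ hx, coordField, ← map_smul, ← map_sum]
  rw [hinv.inverse_apply_eq]
  ext i
  simp [Pi.single_apply]

variable [IsManifold (𝓡 4) ∞ M]

lemma mdifferentiableAt_coordField (hφ : φ ∈ IsManifold.maximalAtlas (𝓡 4) ∞ M) {x : M}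
    (hx : x ∈ φ.source) (μ : Fin 4) :
    MDifferentiableAt (𝓡 4) ((𝓡 4).prod 𝓘(ℝ, E4)) (T% (coordField φ μ)) x := by
  let V (y : E4) : TangentSpace 𝓘(ℝ, E4) y := (EuclideanSpace.single μ 1 : E4)
  have hV : ContMDiffAt 𝓘(ℝ, E4) (𝓘(ℝ, E4).prod 𝓘(ℝ, E4)) 1 (T% V) (φ x) :=
    contMDiffAt_vectorSpace_iff_contDiffAt.2 contDiffAt_const
  exact (hV.mdifferentiableAt one_ne_zero).mpullback_vectorField (n := ∞)
    (contMDiffAt_of_mem_maximalAtlas hφ hx) (isInvertible_mvfderiv_chart hφ hx) (by norm_cast)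

end Charts

section Proof

variable {M : Type*} [TopologicalSpace M] [ChartedSpace E4 M] [IsManifold (𝓡 4) ∞ M]

/-! ### The Clifford algebra of a tangent space -/

section Clifford

variable (g : LorentzMetric M)

lemma LorentzMetric.toCl_mul_self (x : M) (v : TangentSpace (𝓡 4) x) :
    g.toCl x v * g.toCl x v = algebraMap ℝ _ (g.val x v v) := by
  rw [CliffordAlgebra.ι_sq_scalar]
  rfl

lemma LorentzMetric.toCl_mul_add_swap (x : M) (v w : TangentSpace (𝓡 4) x) :
    g.toCl x v * g.toCl x w + g.toCl x w * g.toCl x v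
      = algebraMap ℝ _ (2 * g.val x v w) := by
  rw [CliffordAlgebra.ι_mul_ι_add_swap]
  congr 1
  simp [QuadraticMap.polar, LorentzMetric.quadAt, LorentzMetric.bilinAt, g.symm x w v]
  ring

lemma LorentzMetric.toCl_injective (x : M) : Function.Injective (g.toCl x) := by
  intro v w h
  apply ExteriorAlgebra.ι_leftInverse (R := ℝ).injective
  have := congrArg (CliffordAlgebra.equivExterior (g.quadAt x)) h
  simpa [CliffordAlgebra.changeForm_ι] using this

variable {g} (e : Tetrad g)

lemma Tetrad.basisAt_apply (x : M) (a : Fin 4) : e.basisAt x a = e.vec a x := by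
  simp [Tetrad.basisAt]

lemma Tetrad.multivectorBasis_empty (x : M) : e.multivectorBasis x ∅ = 1 := by
  rw [Tetrad.multivectorBasis, Basis.map_apply, LinearEquiv.symm_apply_eq,
    ExteriorAlgebra.basis_apply_ofCard (n := 0) _ Finset.card_empty,
    ExteriorAlgebra.ιMulti_family, ExteriorAlgebra.ιMulti_zero_apply]
  simp

/-- The tetrad vectors being orthogonal, the Clifford product of two of them is their exterior
product. -/
lemma Tetrad.multivectorBasis_pair (x : M) {a c : Fin 4} (hac : a < c) :
    e.multivectorBasis x {a, c} = g.toCl x (e.vec a x) * g.toCl x (e.vec c x) := by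
  have hcard : ({a, c} : Finset (Fin 4)).card = 2 := Finset.card_pair hac.ne
  -- The exterior basis lists the elements of `{a, c}` in increasing order.
  have hemb : ![a, c] = Finset.orderEmbOfFin {a, c} hcard := by
    apply Finset.orderEmbOfFin_unique
    · intro i
      fin_cases i <;> simp
    · intro i j hij
      fin_cases i <;> fin_cases j <;> simp_all
  rw [Tetrad.multivectorBasis, Basis.map_apply, LinearEquiv.symm_apply_eq,
    ExteriorAlgebra.basis_apply_ofCard (n := 2) _ hcard, ExteriorAlgebra.ιMulti_family,
    Set.powersetCard.ofFinEmbEquiv_symm_apply]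
  have horth : QuadraticMap.associated (R := ℝ) (-g.quadAt x) (e.vec a x) (e.vec c x) = 0 := by
    have h1 := e.orthonormal x a c
    have h2 := e.orthonormal x c a
    simp [hac.ne, hac.ne'] at h1 h2
    simp [QuadraticMap.associated_apply, LorentzMetric.quadAt, LorentzMetric.bilinAt, h1, h2]
  erw [← hemb]
  rw [CliffordAlgebra.equivExterior, CliffordAlgebra.changeFormEquiv_apply,
    CliffordAlgebra.changeForm_ι_mul_ι, horth, map_zero, sub_zero, ExteriorAlgebra.ιMulti_apply]
  simp [e.basisAt_apply]

/-- The components of `e_a e_0` in the multivector basis; they are the same at every point of `M`. -/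
noncomputable def vecMulVecZeroCoord (a : Fin 4) : Finset (Fin 4) →₀ ℝ :=
  if a = 0 then Finsupp.single ∅ 1 else - Finsupp.single {0, a} 1

lemma Tetrad.multivectorBasis_repr_vec_mul_vec_zero (x : M) (a : Fin 4) :
    (e.multivectorBasis x).repr (g.toCl x (e.vec a x) * g.toCl x (e.vec 0 x))
      = vecMulVecZeroCoord a := by
  unfold vecMulVecZeroCoord
  split_ifs with ha
  · subst ha
    rw [g.toCl_mul_self, e.orthonormal]
    simp [eta, ← e.multivectorBasis_empty x]
  · have h := g.toCl_mul_add_swap x (e.vec a x) (e.vec 0 x)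
    rw [e.orthonormal, if_neg ha, mul_zero, map_zero,
      ← e.multivectorBasis_pair x (Fin.pos_of_ne_zero ha)] at h
    rw [eq_neg_of_add_eq_zero_left h]
    simp

lemma Tetrad.sum_eta_smul_vec (x : M) (v : TangentSpace (𝓡 4) x) :
    ∑ a, (eta a * g.val x v (e.vec a x)) • e.vec a x = v := by
  conv_rhs => rw [← (e.basisAt x).sum_repr v]
  refine Finset.sum_congr rfl fun a _ ↦ ?_
  conv_lhs => rw [← (e.basisAt x).sum_repr v]
  simp only [map_sum, map_smul, FunLike.coe_sum, Finset.sum_apply,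
    FunLike.coe_smul, Pi.smul_apply, e.basisAt_apply, e.orthonormal, smul_eq_mul, mul_ite, mul_zero,
    Finset.sum_ite_eq', Finset.mem_univ, if_true]
  rw [mul_left_comm, eta_mul_self, mul_one]

end Clifford

/-! ### Leibniz rule for the Clifford derivative -/

variable {g : LorentzMetric M}

lemma LorentzMetric.mdifferentiableAt_val {Y Z : Π x : M, TangentSpace (𝓡 4) x} {x : M}
    (hY : MDifferentiableAt (𝓡 4) ((𝓡 4).prod 𝓘(ℝ, E4)) (T% Y) x)
    (hZ : MDifferentiableAt (𝓡 4) ((𝓡 4).prod 𝓘(ℝ, E4)) (T% Z) x) :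
    MDifferentiableAt (𝓡 4) 𝓘(ℝ, ℝ) (fun y ↦ g.val y (Y y) (Z y)) x := by
  have h : MDifferentiableAt (𝓡 4) ((𝓡 4).prod 𝓘(ℝ, ℝ))
      (fun y ↦ TotalSpace.mk' ℝ (E := Bundle.Trivial M ℝ) y (g.val y (Y y) (Z y))) x :=
    MDifferentiableAt.clm_bundle_apply₂ (F₁ := E4) (F₂ := E4)
      ((g.contMDiff x).mdifferentiableAt (by simp)) hY hZ
  simpa [mdifferentiableAt_section] using h

lemma Tetrad.mdifferentiableAt (e : Tetrad g) (a : Fin 4) (x : M) :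
    MDifferentiableAt (𝓡 4) ((𝓡 4).prod 𝓘(ℝ, E4)) (T% (e.vec a)) x :=
  (e.contMDiff a x).mdifferentiableAt (by simp)

/-- The endomorphism `Ω_v : w ↦ ω_v^b_c w^c e_b` of `T_x M` given by the connection form of `D` in
the tetrad. The definition uses `-g(D_v e_b, w)`, which for a metric connection equals
`g(e_b, D_v e_c) w^c`; see `IsLeviCivita.connectionEndo_eq_sum`. -/
noncomputable def connectionEndo (e : Tetrad g) (D : LinearConnection M) (x : M)
    (v w : TangentSpace (𝓡 4) x) : TangentSpace (𝓡 4) x :=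
  -∑ b, (eta b * g.val x (D (e.vec b) x v) w) • e.vec b x

/-- `∂_v X` for a vector field `X`: differentiation along `v` of the components
`X^b = η^{bb} g(X, e_b)` in the tetrad. -/
noncomputable def partialDerivVec (e : Tetrad g) (X : Π x : M, TangentSpace (𝓡 4) x) (x : M)
    (v : TangentSpace (𝓡 4) x) : TangentSpace (𝓡 4) x :=
  ∑ b, (eta b * mvfderiv (𝓡 4) (fun y ↦ g.val y (X y) (e.vec b y)) x v) • e.vec b x

variable {D : LinearConnection M}

lemma IsLeviCivita.deriv_eq (hD : IsLeviCivita g D) (e : Tetrad g)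
    {X : Π x : M, TangentSpace (𝓡 4) x} {x : M} (v : TangentSpace (𝓡 4) x)
    (hX : MDifferentiableAt (𝓡 4) ((𝓡 4).prod 𝓘(ℝ, E4)) (T% X) x) :
    D X x v = partialDerivVec e X x v + connectionEndo e D x v (X x) := by
  conv_lhs => rw [← e.sum_eta_smul_vec x (D X x v)]
  rw [partialDerivVec, connectionEndo, ← sub_eq_add_neg, ← Finset.sum_sub_distrib]
  refine Finset.sum_congr rfl fun b _ ↦ ?_
  rw [hD.metric x v X (e.vec b) hX (e.mdifferentiableAt b x), ← sub_smul,
    g.symm x (D (e.vec b) x v)]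
  congr 1
  ring

lemma IsLeviCivita.val_deriv_vec_antisymm (hD : IsLeviCivita g D) (e : Tetrad g) (x : M)
    (v : TangentSpace (𝓡 4) x) (b c : Fin 4) :
    g.val x (e.vec b x) (D (e.vec c) x v) = - g.val x (D (e.vec b) x v) (e.vec c x) := by
  have h := hD.metric x v (e.vec b) (e.vec c) (e.mdifferentiableAt b x) (e.mdifferentiableAt c x)
  simp only [e.orthonormal, mvfderiv_const, FunLike.coe_zero, Pi.zero_apply] at h
  linarith

lemma partialDerivVec_vec (e : Tetrad g) (a : Fin 4) (x : M) (v : TangentSpace (𝓡 4) x) :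
    partialDerivVec e (e.vec a) x v = 0 := by
  simp [partialDerivVec, e.orthonormal, mvfderiv_const]

lemma IsLeviCivita.connectionEndo_eq_sum (hD : IsLeviCivita g D) (e : Tetrad g) (x : M)
    (v w : TangentSpace (𝓡 4) x) :
    connectionEndo e D x v w = ∑ b, ∑ c,
      (eta b * eta c * g.val x (e.vec b x) (D (e.vec c) x v) * g.val x (e.vec c x) w) •
        e.vec b x := by
  rw [connectionEndo, ← Finset.sum_neg_distrib]
  refine Finset.sum_congr rfl fun b _ ↦ ?_
  -- `g(D_v e_b, w)` is expanded by inserting `w = w^c e_c`.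
  conv_lhs => rw [← e.sum_eta_smul_vec x w]
  rw [← Finset.sum_smul, ← neg_smul]
  congr 1
  rw [map_sum, Finset.mul_sum, ← Finset.sum_neg_distrib]
  refine Finset.sum_congr rfl fun c _ ↦ ?_
  rw [hD.val_deriv_vec_antisymm, map_smul, smul_eq_mul, g.symm x w]
  ring

/-- The connection bivector acts on vectors by `½ [ω_v, w] = Ω_v w`; this is where the skewness of
the connection form is used. -/
lemma IsLeviCivita.half_commutator_connectionBivector (hD : IsLeviCivita g D) (e : Tetrad g)
    (x : M) (v w : TangentSpace (𝓡 4) x) :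
    (1 / 2 : ℝ) • (connectionBivector e D x v * g.toCl x w
        - g.toCl x w * connectionBivector e D x v)
      = g.toCl x (connectionEndo e D x v w) := by
  -- The relation `v w + w v = 2 g(v, w)`, applied twice.
  have key (b c : Fin 4) :
      g.toCl x (e.vec b x) * g.toCl x (e.vec c x) * g.toCl x w
        - g.toCl x w * (g.toCl x (e.vec b x) * g.toCl x (e.vec c x))
      = (2 * g.val x (e.vec c x) w) • g.toCl x (e.vec b x)
        - (2 * g.val x (e.vec b x) w) • g.toCl x (e.vec c x) := by
    rw [Algebra.smul_def, Algebra.smul_def, Algebra.commutes, ← g.toCl_mul_add_swap,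
      ← g.toCl_mul_add_swap]
    noncomm_ring
  have hswap : ∑ b, ∑ c, (eta b * eta c * g.val x (e.vec b x) (D (e.vec c) x v)
        * g.val x (e.vec b x) w) • g.toCl x (e.vec c x)
      = - g.toCl x (connectionEndo e D x v w) := by
    rw [Finset.sum_comm, hD.connectionEndo_eq_sum, map_sum, ← Finset.sum_neg_distrib]
    refine Finset.sum_congr rfl fun b _ ↦ ?_
    rw [map_sum, ← Finset.sum_neg_distrib]
    refine Finset.sum_congr rfl fun c _ ↦ ?_
    rw [map_smul, ← neg_smul, hD.val_deriv_vec_antisymm, g.symm x (D (e.vec c) x v)]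
    congr 1
    ring
  have hsum : connectionBivector e D x v * g.toCl x w - g.toCl x w * connectionBivector e D x v
      = ∑ b, ∑ c, (eta b * eta c * g.val x (e.vec b x) (D (e.vec c) x v)
            * g.val x (e.vec c x) w) • g.toCl x (e.vec b x)
        - ∑ b, ∑ c, (eta b * eta c * g.val x (e.vec b x) (D (e.vec c) x v)
            * g.val x (e.vec b x) w) • g.toCl x (e.vec c x) := by
    simp only [connectionBivector, smul_mul_assoc, mul_smul_comm, Finset.sum_mul, Finset.mul_sum,
      ← smul_sub, ← Finset.sum_sub_distrib, key, Finset.smul_sum]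
    refine Finset.sum_congr rfl fun b _ ↦ Finset.sum_congr rfl fun c _ ↦ ?_
    module
  rw [hsum, hswap, hD.connectionEndo_eq_sum]
  simp only [map_sum, map_smul]
  module

/-- The products `e_b e_0` have constant components, so `∂_v` only differentiates the components
of `X`. -/
lemma partialDeriv_toCl_mul_vec_zero (e : Tetrad g)
    {X : Π x : M, TangentSpace (𝓡 4) x} {x : M} (v : TangentSpace (𝓡 4) x)
    (hX : MDifferentiableAt (𝓡 4) ((𝓡 4).prod 𝓘(ℝ, E4)) (T% X) x) :
    partialDeriv e (fun y ↦ g.toCl y (X y) * g.toCl y (e.vec 0 y)) x v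
      = g.toCl x (partialDerivVec e X x v) * g.toCl x (e.vec 0 x) := by
  have hrepr (S : Finset (Fin 4)) :
      (fun y ↦ (e.multivectorBasis y).repr (g.toCl y (X y) * g.toCl y (e.vec 0 y)) S)
      = ∑ b, fun y ↦ (eta b * vecMulVecZeroCoord b S) * g.val y (X y) (e.vec b y) := by
    funext y
    conv_lhs => rw [← e.sum_eta_smul_vec y (X y)]
    simp only [map_sum, map_smul, Finset.sum_mul, smul_mul_assoc, Finsupp.coe_finsetSum,
      Finset.sum_apply, Finsupp.smul_apply, e.multivectorBasis_repr_vec_mul_vec_zero, smul_eq_mul]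
    exact Finset.sum_congr rfl fun b _ ↦ by ring
  have hd (S : Finset (Fin 4)) : mvfderiv (𝓡 4)
      (fun y ↦ (e.multivectorBasis y).repr (g.toCl y (X y) * g.toCl y (e.vec 0 y)) S) x v
      = ∑ b, eta b * vecMulVecZeroCoord b S
          * mvfderiv (𝓡 4) (fun y ↦ g.val y (X y) (e.vec b y)) x v := by
    have hb (b : Fin 4) := (g.mdifferentiableAt_val hX (e.mdifferentiableAt b x)).hasMFDerivAt
    have hs := HasMFDerivAt.sum (t := Finset.univ) fun b _ ↦
      (hb b).const_smul (eta b * vecMulVecZeroCoord b S)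
    rw [hrepr, mvfderiv]
    erw [hs.mfderiv]
    simp [mvfderiv]
    rfl
  simp only [partialDeriv, hd, partialDerivVec]
  simp only [map_sum, Finset.sum_mul, Finset.sum_smul, map_smul, smul_mul_assoc]
  rw [Finset.sum_comm]
  refine Finset.sum_congr rfl fun b _ ↦ ?_
  rw [← (e.multivectorBasis x).sum_repr (g.toCl x (e.vec b x) * g.toCl x (e.vec 0 x)),
    Finset.smul_sum, e.multivectorBasis_repr_vec_mul_vec_zero]
  exact Finset.sum_congr rfl fun S _ ↦ by module

/-- The Clifford derivative `D_v` is a derivation on products `X e_0`, compatible with the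
connection on vectors. -/
lemma IsLeviCivita.cliffordDeriv_toCl_mul_vec_zero (hD : IsLeviCivita g D) (e : Tetrad g)
    {X : Π x : M, TangentSpace (𝓡 4) x} {x : M} (v : TangentSpace (𝓡 4) x)
    (hX : MDifferentiableAt (𝓡 4) ((𝓡 4).prod 𝓘(ℝ, E4)) (T% X) x) :
    cliffordDeriv e D (fun y ↦ g.toCl y (X y) * g.toCl y (e.vec 0 y)) x v
      = g.toCl x (D X x v) * g.toCl x (e.vec 0 x)
        + g.toCl x (X x) * g.toCl x (D (e.vec 0) x v) := by
  rw [cliffordDeriv, partialDeriv_toCl_mul_vec_zero e v hX, hD.deriv_eq e v hX,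
    hD.deriv_eq e v (e.mdifferentiableAt 0 x), partialDerivVec_vec, zero_add, map_add,
    ← hD.half_commutator_connectionBivector, ← hD.half_commutator_connectionBivector]
  simp only [smul_mul_assoc, mul_smul_comm, add_mul, add_assoc, ← smul_add]
  congr 2
  noncomm_ring

/-! ### Sachs' rule -/

variable {φ : OpenPartialHomeomorph M E4}

/-- Sachs' rule at a point is the vanishing of `e_μ (D_{e_ν} e_0)`. -/
lemma IsLeviCivita.sachsRuleAt_iff_mul_eq_zero (hD : IsLeviCivita g D) (e : Tetrad g)
    (hφ : φ ∈ IsManifold.maximalAtlas (𝓡 4) ∞ M) {x : M} (hx : x ∈ φ.source) (ν μ : Fin 4) :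
    SachsRuleAt e D φ ν μ x ↔
      g.toCl x (coordField φ μ x) * g.toCl x (D (e.vec 0) x (coordField φ ν x)) = 0 := by
  have hΓ : ∑ α, connCoeff D φ α ν μ x • paravector e φ α x
      = g.toCl x (D (coordField φ μ) x (coordField φ ν x)) * g.toCl x (e.vec 0 x) := by
    conv_rhs => rw [← sum_mvfderiv_smul_coordField hφ hx (D (coordField φ μ) x (coordField φ ν x))]
    simp only [map_sum, map_smul, Finset.sum_mul, smul_mul_assoc]
    rfl
  have hL := hD.cliffordDeriv_toCl_mul_vec_zero e (coordField φ ν x)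
    (mdifferentiableAt_coordField hφ hx μ)
  rw [SachsRuleAt, hΓ, show paravector e φ μ
    = fun y ↦ g.toCl y (coordField φ μ y) * g.toCl y (e.vec 0 y) from rfl, hL, add_eq_left]

lemma IsLeviCivita.forall_sachsRuleAt_iff (hD : IsLeviCivita g D) (e : Tetrad g)
    (hφ : φ ∈ IsManifold.maximalAtlas (𝓡 4) ∞ M) {x : M} (hx : x ∈ φ.source) (ν : Fin 4) :
    (∀ μ, SachsRuleAt e D φ ν μ x) ↔ D (e.vec 0) x (coordField φ ν x) = 0 := by
  simp only [hD.sachsRuleAt_iff_mul_eq_zero e hφ hx]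
  refine ⟨fun h ↦ ?_, fun h μ ↦ by rw [h, map_zero, mul_zero]⟩
  -- By linearity `e_0 w = 0` for `w = D_{e_ν} e_0`; multiply by `e_0` on the left.
  have h0 : g.toCl x (e.vec 0 x) * g.toCl x (D (e.vec 0) x (coordField φ ν x)) = 0 := by
    rw [← sum_mvfderiv_smul_coordField hφ hx (e.vec 0 x)]
    simp only [map_sum, map_smul, Finset.sum_mul, smul_mul_assoc, h, smul_zero,
      Finset.sum_const_zero]
  have h1 : g.toCl x (e.vec 0 x) * g.toCl x (e.vec 0 x) = 1 := by
    rw [g.toCl_mul_self, e.orthonormal]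
    simp [eta]
  apply g.toCl_injective x
  rw [map_zero, ← one_mul (g.toCl x _), ← h1, mul_assoc, h0, mul_zero]

/-! ### Curvature -/

lemma IsLeviCivita.contMDiff_deriv (hD : IsLeviCivita g D) {X Y : Π x : M, TangentSpace (𝓡 4) x}
    (hX : ContMDiff (𝓡 4) ((𝓡 4).prod 𝓘(ℝ, E4)) ∞ (T% X))
    (hY : ContMDiff (𝓡 4) ((𝓡 4).prod 𝓘(ℝ, E4)) ∞ (T% Y)) :
    ContMDiff (𝓡 4) ((𝓡 4).prod 𝓘(ℝ, E4)) ∞ (T% (fun y ↦ D Y y (X y))) := by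
  have h := hD.smooth.contMDiff.contMDiff (σ := Y) (by simpa using hY.contMDiffOn)
  exact (contMDiffOn_univ.1 h).clm_bundle_apply hX

lemma IsLeviCivita.mlieBracket_eq (hD : IsLeviCivita g D) {X Y : Π x : M, TangentSpace (𝓡 4) x}
    (hX : ContMDiff (𝓡 4) ((𝓡 4).prod 𝓘(ℝ, E4)) ∞ (T% X))
    (hY : ContMDiff (𝓡 4) ((𝓡 4).prod 𝓘(ℝ, E4)) ∞ (T% Y)) (x : M) :
    VectorField.mlieBracket (𝓡 4) X Y x = D Y x (X x) - D X x (Y x) :=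
  (D.torsion_eq_zero_iff.1 hD.torsion_eq_zero ((hX x).mdifferentiableAt (by simp))
    ((hY x).mdifferentiableAt (by simp))).symm

lemma IsLeviCivita.contMDiff_mlieBracket (hD : IsLeviCivita g D)
    {X Y : Π x : M, TangentSpace (𝓡 4) x}
    (hX : ContMDiff (𝓡 4) ((𝓡 4).prod 𝓘(ℝ, E4)) ∞ (T% X))
    (hY : ContMDiff (𝓡 4) ((𝓡 4).prod 𝓘(ℝ, E4)) ∞ (T% Y)) :
    ContMDiff (𝓡 4) ((𝓡 4).prod 𝓘(ℝ, E4)) ∞ (T% (VectorField.mlieBracket (𝓡 4) X Y)) := by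
  rw [funext (hD.mlieBracket_eq hX hY)]
  exact (hD.contMDiff_deriv hX hY).sub_section (hD.contMDiff_deriv hY hX)

lemma covariantDeriv_sub {X Y : Π x : M, TangentSpace (𝓡 4) x} {x : M}
    (hX : ContMDiff (𝓡 4) ((𝓡 4).prod 𝓘(ℝ, E4)) ∞ (T% X))
    (hY : ContMDiff (𝓡 4) ((𝓡 4).prod 𝓘(ℝ, E4)) ∞ (T% Y)) :
    D (X - Y) x = D X x - D Y x := by
  have h := D.isCovariantDerivativeOnUniv.add (x := x)
    (((hX.sub_section hY) x).mdifferentiableAt (by simp)) ((hY x).mdifferentiableAt (by simp))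
  rw [sub_add_cancel] at h
  exact eq_sub_of_add_eq h.symm

/-- The first Bianchi identity. Torsion-freeness turns the cyclic sum into the Jacobi identity for
`X`, `Y`, `Z`. -/
lemma IsLeviCivita.bianchi (hD : IsLeviCivita g D) {X Y Z : Π x : M, TangentSpace (𝓡 4) x}
    (hX : ContMDiff (𝓡 4) ((𝓡 4).prod 𝓘(ℝ, E4)) ∞ (T% X))
    (hY : ContMDiff (𝓡 4) ((𝓡 4).prod 𝓘(ℝ, E4)) ∞ (T% Y))
    (hZ : ContMDiff (𝓡 4) ((𝓡 4).prod 𝓘(ℝ, E4)) ∞ (T% Z)) (x : M) :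
    curvature D X Y Z x + curvature D Y Z X x + curvature D Z X Y x = 0 := by
  have hb {U V : Π x : M, TangentSpace (𝓡 4) x}
      (hU : ContMDiff (𝓡 4) ((𝓡 4).prod 𝓘(ℝ, E4)) ∞ (T% U))
      (hV : ContMDiff (𝓡 4) ((𝓡 4).prod 𝓘(ℝ, E4)) ∞ (T% V)) :
      D (VectorField.mlieBracket (𝓡 4) U V) x
        = D (fun y ↦ D V y (U y)) x - D (fun y ↦ D U y (V y)) x := by
    rw [← covariantDeriv_sub (hD.contMDiff_deriv hU hV) (hD.contMDiff_deriv hV hU)]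
    congr 1
    funext y
    exact hD.mlieBracket_eq hU hV y
  have : IsManifold (𝓡 4) (minSmoothness ℝ 3) M := by
    rw [minSmoothness_of_isRCLikeNormedField]
    infer_instance
  have h2 : minSmoothness ℝ 2 ≤ (∞ : WithTop ℕ∞) := by
    rw [minSmoothness_of_isRCLikeNormedField]
    norm_cast
  have hj := VectorField.leibniz_identity_mlieBracket_apply (I := 𝓡 4) (x := x) (U := X) (V := Y)
    (W := Z) ((hX x).of_le h2) ((hY x).of_le h2) ((hZ x).of_le h2)
  rw [VectorField.mlieBracket_swap_apply (V := VectorField.mlieBracket (𝓡 4) X Y),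
    hD.mlieBracket_eq hX (hD.contMDiff_mlieBracket hY hZ),
    hD.mlieBracket_eq hZ (hD.contMDiff_mlieBracket hX hY),
    hD.mlieBracket_eq hY (hD.contMDiff_mlieBracket hX hZ), hb hY hZ, hb hX hY, hb hX hZ,
    VectorField.mlieBracket_swap_apply (V := X) (W := Z), map_neg] at hj
  simp only [curvature]
  simp only [FunLike.coe_sub, Pi.sub_apply] at hj
  rw [← sub_eq_zero] at hj
  rw [← hj]
  abel

/-- Skewness of the curvature operator, `g(Z, R(X, Y) Z) = 0`, for `Z = e_a`. Since `g(e_a, e_a)` is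
constant, the identity `X Y f - Y X f = [X, Y] f` for functions is not needed. -/
lemma IsLeviCivita.val_curvature_vec_self (hD : IsLeviCivita g D) (e : Tetrad g)
    {X Y : Π x : M, TangentSpace (𝓡 4) x}
    (hX : ContMDiff (𝓡 4) ((𝓡 4).prod 𝓘(ℝ, E4)) ∞ (T% X))
    (hY : ContMDiff (𝓡 4) ((𝓡 4).prod 𝓘(ℝ, E4)) ∞ (T% Y)) (a : Fin 4) (x : M) :
    g.val x (e.vec a x) (curvature D X Y (e.vec a) x) = 0 := by
  have h1 (y : M) (v : TangentSpace (𝓡 4) y) : g.val y (e.vec a y) (D (e.vec a) y v) = 0 := by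
    have h := hD.val_deriv_vec_antisymm e y v a a
    rw [g.symm y (D (e.vec a) y v)] at h
    linarith
  have h2 {U : Π x : M, TangentSpace (𝓡 4) x}
      (hU : ContMDiff (𝓡 4) ((𝓡 4).prod 𝓘(ℝ, E4)) ∞ (T% U)) (v : TangentSpace (𝓡 4) x) :
      g.val x (e.vec a x) (D (fun y ↦ D (e.vec a) y (U y)) x v)
        = - g.val x (D (e.vec a) x v) (D (e.vec a) x (U x)) := by
    have h := hD.metric x v (e.vec a) (fun y ↦ D (e.vec a) y (U y)) (e.mdifferentiableAt a x)
      ((hD.contMDiff_deriv hU (e.contMDiff a) x).mdifferentiableAt (by simp))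
    simp only [h1, mvfderiv_const, FunLike.coe_zero, Pi.zero_apply] at h
    linarith
  rw [curvature, map_sub, map_sub, h1, h2 hX, h2 hY,
    g.symm x (D (e.vec a) x (Y x)) (D (e.vec a) x (X x))]
  ring

lemma curvature_eq_zero_of_parallel {Z : Π x : M, TangentSpace (𝓡 4) x}
    (hZ : ∀ (x : M) (v : TangentSpace (𝓡 4) x), D Z x v = 0) (X Y : Π x : M, TangentSpace (𝓡 4) x)
    (x : M) : curvature D X Y Z x = 0 := by
  have h0 : D (fun y ↦ (0 : TangentSpace (𝓡 4) y)) = 0 := D.zero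
  simp [curvature, hZ, h0]

lemma IsLeviCivita.ricci_vec_zero_eq_zero (hD : IsLeviCivita g D) (e : Tetrad g)
    (h0 : ∀ (x : M) (v : TangentSpace (𝓡 4) x), D (e.vec 0) x v = 0)
    {X : Π x : M, TangentSpace (𝓡 4) x}
    (hX : ContMDiff (𝓡 4) ((𝓡 4).prod 𝓘(ℝ, E4)) ∞ (T% X)) (x : M) :
    ricci e D (e.vec 0) X x = 0 := by
  refine Finset.sum_eq_zero fun a _ ↦ ?_
  have hB := hD.bianchi (e.contMDiff a) (e.contMDiff 0) hX x
  rw [curvature_eq_zero_of_parallel h0 X (e.vec a), add_zero] at hB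
  rw [eq_neg_of_add_eq_zero_left hB, map_neg, hD.val_curvature_vec_self e (e.contMDiff 0) hX,
    neg_zero, mul_zero]

end Proof

end SachsRule

theorem mainTheorem8 {M : Type*} [TopologicalSpace M] [ChartedSpace E4 M]
    [IsManifold (𝓡 4) ∞ M] (g : LorentzMetric M) (D : LinearConnection M)
    (hD : IsLeviCivita g D) (e : Tetrad g) :
    (∀ φ ∈ IsManifold.maximalAtlas (𝓡 4) ∞ M, ∀ ν : Fin 4,
      (∀ μ : Fin 4, ∀ x ∈ φ.source, SachsRuleAt e D φ ν μ x) ↔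
        ∀ x ∈ φ.source, D (e.vec 0) x (coordField φ ν x) = 0) ∧
    ((∀ φ ∈ IsManifold.maximalAtlas (𝓡 4) ∞ M, ∀ ν μ : Fin 4, ∀ x ∈ φ.source,
        SachsRuleAt e D φ ν μ x) ↔
      ∀ (x : M) (v : TangentSpace (𝓡 4) x), D (e.vec 0) x v = 0) ∧
    ((∀ (x : M) (v : TangentSpace (𝓡 4) x), D (e.vec 0) x v = 0) →
      ∀ X : Π x : M, TangentSpace (𝓡 4) x,
        ContMDiff (𝓡 4) ((𝓡 4).prod 𝓘(ℝ, E4)) ∞ (T% X) →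
        ∀ x : M, ricci e D (e.vec 0) X x = 0) := by
  refine ⟨fun φ hφ ν ↦ ?_, ⟨fun h x v ↦ ?_, fun h φ hφ ν μ x hx ↦ ?_⟩,
    fun h X hX x ↦ hD.ricci_vec_zero_eq_zero e h hX x⟩
  · rw [forall_comm]
    refine forall_congr' fun x ↦ ?_
    rw [forall_comm]
    exact forall_congr' fun hx ↦ hD.forall_sachsRuleAt_iff e hφ hx ν
  · have hφ := IsManifold.chart_mem_maximalAtlas (I := 𝓡 4) (n := ∞) x
    have hx := mem_chart_source E4 x
    rw [← sum_mvfderiv_smul_coordField hφ hx v, map_sum]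
    refine Finset.sum_eq_zero fun ν _ ↦ ?_
    rw [map_smul, (hD.forall_sachsRuleAt_iff e hφ hx ν).1 fun μ ↦ h _ hφ ν μ x hx, smul_zero]
  · exact (hD.forall_sachsRuleAt_iff e hφ hx ν).2 (h x _) μ
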